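/- Let $\mathcal H$ be a separable complex Hilbert space. For a bounded operator $A$ on $\mathcal H$ and $p>0$ put $|A|=(A^*A)^{1/2}$ and $\|A\|_p=(\operatorname{tr}|A|^p)^{1/p}\in[0,\infty]$, and let the Schatten class $C_p$ be the set of all compact operators $A$ on $\mathcal H$ with $\|A\|_p<\infty$. Let $p>0$ and let $A_1,\dots,A_n,B_1,\dots,B_n\in C_p$ be such that $\sum_{i,j=1}^n A_i^*B_j=0$. Then $A_i+B_j$ and $A_i-B_j$ belong to $C_p$ for all $i,j$, and for each of the two choices of the sign $\pm$ (the same sign in all terms of the sum) the following hold. If $0<p\le 2$, then $$2^{p/2-1}\,n^{p-1}\Big(\sum_{i=1}^n\|A_i\|_p^p+\sum_{i=1}^n\|B_i\|_p^p\Big)\le\sum_{i,j=1}^n\|A_i\pm B_j\|_p^p ;$$ and if $2\le p<\infty$, then $$\sum_{i,j=1}^n\|A_i\pm B_j\|_p^p\le 2^{p/2-1}\,n^{p-1}\Big(\sum_{i=1}^n\|A_i\|_p^p+\sum_{i=1}^n\|B_i\|_p^p\Big).$$ -/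

import Mathlib

open scoped ENNReal InnerProductSpace

noncomputable section

namespace SchattenClass

variable {H : Type*} [NormedAddCommGroup H] [InnerProductSpace ℂ H] [CompleteSpace H]

set_option linter.unusedSectionVars false

/-- The sum of the diagonal entries `⟪e i, T (e i)⟫` in a Hilbert basis `e`, as an element of
`[0, ∞]`; it is meant for positive operators `T`, whose diagonal entries are nonnegative reals. -/
def diagSum {ι : Type*} (e : HilbertBasis ι ℂ H) (T : H →L[ℂ] H) : ℝ≥0∞ :=
  ∑' i, ENNReal.ofReal (RCLike.re ⟪e i, T (e i)⟫_ℂ)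

variable (H) in
/-- Index set of a Hilbert basis of `H`. -/
def basisIndex : Set H := (exists_hilbertBasis ℂ H).choose

variable (H) in
/-- A Hilbert basis (complete orthonormal system) of `H`. -/
def basis : HilbertBasis (basisIndex H) ℂ H := (exists_hilbertBasis ℂ H).choose_spec.choose

/-- The trace, with values in `[0, ∞]`, of a positive operator. It does not depend on the Hilbert
basis, see `diagSum_eq_posTrace`. -/
def posTrace (T : H →L[ℂ] H) : ℝ≥0∞ := diagSum (basis H) T

/-- Parseval's identity in `[0, ∞]`. -/
theorem tsum_ofReal_norm_inner_sq {ι : Type*} (e : HilbertBasis ι ℂ H) (x : H) :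
    ∑' i, ENNReal.ofReal (‖⟪e i, x⟫_ℂ‖ ^ 2) = ENNReal.ofReal (‖x‖ ^ 2) := by
  have h : HasSum (fun i => ‖⟪e i, x⟫_ℂ‖ ^ 2) (‖x‖ ^ 2) := by
    have h1 := (e.hasSum_inner_mul_inner x x).mapL Complex.reCLM
    have h2 : Complex.reCLM ⟪x, x⟫_ℂ = ‖x‖ ^ 2 := by
      rw [inner_self_eq_norm_sq_to_K]; simp [← Complex.ofReal_pow]
    rw [h2] at h1
    refine h1.congr_fun ?_
    intro i
    rw [← inner_conj_symm x (e i), RCLike.conj_mul]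
    simp [← Complex.ofReal_pow]
  rw [← h.tsum_eq, ENNReal.ofReal_tsum_of_nonneg (fun i => by positivity) h.summable]

/-- The trace of a positive operator can be computed in every Hilbert basis. -/
theorem diagSum_eq_posTrace {ι : Type*} (e : HilbertBasis ι ℂ H) {T : H →L[ℂ] H} (hT : 0 ≤ T) :
    diagSum e T = posTrace T := by
  obtain ⟨S, hS, hST⟩ : ∃ S : H →L[ℂ] H, IsSelfAdjoint S ∧ S * S = T :=
    ⟨CFC.sqrt T, (CFC.sqrt_nonneg T).isSelfAdjoint, CFC.sqrt_mul_sqrt_self T hT⟩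
  have hsymm : ∀ x y, ⟪S x, y⟫_ℂ = ⟪x, S y⟫_ℂ := fun x y =>
    (ContinuousLinearMap.isSelfAdjoint_iff_isSymmetric.mp hS) x y
  have key : ∀ x, ENNReal.ofReal (RCLike.re ⟪x, T x⟫_ℂ) = ENNReal.ofReal (‖S x‖ ^ 2) := by
    intro x
    rw [← hST, mul_apply_eq_comp, ← hsymm, inner_self_eq_norm_sq]
  unfold posTrace diagSum
  simp only [key]
  simp only [← tsum_ofReal_norm_inner_sq (basis H) (S (e _))]
  rw [ENNReal.tsum_comm]
  refine tsum_congr fun j => ?_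
  rw [← tsum_ofReal_norm_inner_sq e]
  refine tsum_congr fun i => ?_
  rw [← hsymm, norm_inner_symm]

/-- The quantity `‖A‖_p = (tr |A|^p)^(1/p)`, where `|A| = (A* A)^(1/2)`, with values in
`[0, ∞]`. -/
def schattenENorm (p : ℝ) (A : H →L[ℂ] H) : ℝ≥0∞ :=
  (posTrace (CFC.abs A ^ p)) ^ (1 / p)

/-- Membership in the Schatten class `C_p`: compact operators `A` for which `‖A‖_p` is finite. -/
def MemSchatten (p : ℝ) (A : H →L[ℂ] H) : Prop :=
  IsCompactOperator A ∧ schattenENorm p A < ∞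

/-- The Schatten `p`-norm (quasi-norm if `p < 1`) as a real number; used for members of `C_p`. -/
def schattenNorm (p : ℝ) (A : H →L[ℂ] H) : ℝ :=
  (schattenENorm p A).toReal

end SchattenClass

end

/-!
Write `q = p / 2`, so that `‖A‖_p ^ p = tr (A* A) ^ q`. Since `∑ A_i* B_j = 0`,
`∑_{i,j} |A_i + B_j|² = n (∑ |A_i|² + ∑ |B_i|²)`: two families of positive compact operators, of
`n²` members and of `2 n²` members (each of the `|A_i|²`, `|B_i|²` repeated `n` times), have the same
sum. It therefore suffices to compare, for a finite family of `m` positive compact operators `T_i`,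
the numbers `∑ tr (T_i ^ q)` and `tr ((∑ T_i) ^ q)`. For `q ≥ 1`,
`∑ tr (T_i ^ q) ≤ tr ((∑ T_i) ^ q) ≤ m ^ (q - 1) ∑ tr (T_i ^ q)`,
and both inequalities are reversed for `0 < q ≤ 1`
(`sum_posTrace_rpow_le`, `posTrace_sum_rpow_le_card_mul`, `posTrace_sum_rpow_le`,
`card_mul_sum_posTrace_rpow_le`). The sign `-` follows by replacing `B_j` with `-B_j`, and
membership in `C_p` follows in the same way from the parallelogram identity.

All four trace inequalities are instances of Jensen's inequality for infinite matrices with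
nonnegative entries (`tsum_rpow_le_of_substochastic`, `le_tsum_rpow_of_substochastic`). Let `e_b` be
an eigenbasis of `S = ∑ T_i` with eigenvalues `y_b`, and let `f_a`, `a = (i, k)`, run through
eigenbases of all the `T_i`, with eigenvalues `x_a`. Then `y_b = ∑_a |⟪f_a, e_b⟫|² x_a`, where the
row sums are `m` and the column sums are `1`. In the other direction, Parseval's identity gives
`x_a = ∑_b W_ab y_b` with `W_ab = x_a |⟪f_a, e_b⟫|² / y_b`; here the column sums are `1` where
`y_b ≠ 0`, and the row sums are at most `1` because the rank one operator `x_a f_a f_a*` is at most `S`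
(`tsum_div_le_one_of_le_qform`).
-/

namespace SchattenClass

open scoped NNReal ComplexOrder

universe u w

/-! ### Jensen's inequality for substochastic matrices -/

/-- Jensen's inequality for `t ↦ t ^ q`, `1 ≤ q`, with infinitely many weights of total mass at most
`1`. -/
theorem rpow_tsum_mul_le {β : Type*} (w x : β → ℝ≥0∞) {q : ℝ} (hq : 1 ≤ q)
    (hw : ∑' b, w b ≤ 1) : (∑' b, w b * x b) ^ q ≤ ∑' b, w b * x b ^ q := by
  classical
  have hq0 : 0 < q := by linarith
  rw [← ENNReal.le_rpow_inv_iff hq0, ENNReal.tsum_eq_iSup_sum]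
  refine iSup_le ?_
  intro s
  rw [ENNReal.le_rpow_inv_iff hq0]
  have hs : ∑ b ∈ s, w b ≤ 1 := (ENNReal.sum_le_tsum s).trans hw
  -- The missing mass `1 - ∑ w` is given to an extra index, where the function vanishes.
  have h := ENNReal.rpow_arith_mean_le_arith_mean_rpow (Finset.insertNone s)
    (fun o => o.elim (1 - ∑ b ∈ s, w b) w) (fun o => o.elim 0 x)
    (by simp [tsub_add_cancel_of_le hs]) hq
  simp only [Finset.sum_insertNone, Option.elim_none, Option.elim_some, mul_zero, zero_add,
    ENNReal.zero_rpow_of_pos hq0] at h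
  exact h.trans (ENNReal.sum_le_tsum s)

/-- Jensen's inequality for `t ↦ t ^ q`, `0 < q ≤ 1`: the convex case with exponent `q⁻¹`, applied to
the values `x b ^ q`. -/
theorem tsum_mul_rpow_le {β : Type*} (w x : β → ℝ≥0∞) {q : ℝ} (hq0 : 0 < q) (hq : q ≤ 1)
    (hw : ∑' b, w b ≤ 1) : ∑' b, w b * x b ^ q ≤ (∑' b, w b * x b) ^ q := by
  have h := rpow_tsum_mul_le w (fun b => x b ^ q) (one_le_inv₀ hq0 |>.mpr hq) hw
  simp only [← ENNReal.rpow_mul, mul_inv_cancel₀ hq0.ne', ENNReal.rpow_one] at h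
  have := ENNReal.rpow_le_rpow h hq0.le
  rwa [← ENNReal.rpow_mul, inv_mul_cancel₀ hq0.ne', ENNReal.rpow_one] at this

theorem tsum_rpow_le_of_substochastic {α β : Type*} (W : α → β → ℝ≥0∞) (x : α → ℝ≥0∞)
    (y : β → ℝ≥0∞) {q : ℝ} (hq : 1 ≤ q) (hW : ∀ a, ∑' b, W a b ≤ 1)
    (hx : ∀ a, ∑' b, W a b * y b = x a) :
    ∑' a, x a ^ q ≤ ∑' b, (∑' a, W a b) * y b ^ q := by
  simp only [← ENNReal.tsum_mul_right]
  rw [ENNReal.tsum_comm]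
  refine ENNReal.tsum_le_tsum fun a => ?_
  rw [← hx a]
  exact rpow_tsum_mul_le _ _ hq (hW a)

theorem le_tsum_rpow_of_substochastic {α β : Type*} (W : α → β → ℝ≥0∞) (x : α → ℝ≥0∞)
    (y : β → ℝ≥0∞) {q : ℝ} (hq0 : 0 < q) (hq : q ≤ 1) (hW : ∀ a, ∑' b, W a b ≤ 1)
    (hx : ∀ a, ∑' b, W a b * y b = x a) :
    ∑' b, (∑' a, W a b) * y b ^ q ≤ ∑' a, x a ^ q := by
  simp only [← ENNReal.tsum_mul_right]
  rw [ENNReal.tsum_comm]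
  refine ENNReal.tsum_le_tsum fun a => ?_
  rw [← hx a]
  exact tsum_mul_rpow_le _ _ hq0 hq (hW a)

/-! ### Quadratic forms of positive operators -/

section QuadraticForm

variable {H : Type u} [NormedAddCommGroup H] [InnerProductSpace ℂ H]

/-- The quadratic form `x ↦ ⟪x, T x⟫` as an element of `[0, ∞]`; it is meant for positive operators,
whose quadratic form is real and nonnegative. -/
noncomputable def qform (T : H →L[ℂ] H) (x : H) : ℝ≥0∞ := ENNReal.ofReal (RCLike.re ⟪x, T x⟫_ℂ)

theorem qform_sum {κ : Type*} [Fintype κ] {T : κ → H →L[ℂ] H} (hT : ∀ i, 0 ≤ T i) (x : H) :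
    qform (∑ i, T i) x = ∑ i, qform (T i) x := by
  unfold qform
  rw [← ENNReal.ofReal_sum_of_nonneg]
  · simp
  · intro i _
    exact ((ContinuousLinearMap.nonneg_iff_isPositive _).mp (hT i)).re_inner_nonneg_right x

theorem qform_eigenvector {T : H →L[ℂ] H} {x : H} {l : ℝ≥0} (hx : T x = ((l : ℝ) : ℂ) • x)
    (h1 : ‖x‖ = 1) : qform T x = l := by
  rw [qform, hx, inner_smul_right, inner_self_eq_norm_sq_to_K, h1]
  simp

/-- If the rank one operator `m f f*` is at most `S`, then `m ⟪f, S⁻¹ f⟫ ≤ 1`, written in an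
eigenbasis of `S`. Where `l i = 0` the numerator vanishes as well, so that the quotient is `0`. -/
theorem tsum_div_le_one_of_le_qform {S : H →L[ℂ] H} {ι : Type*} (e : HilbertBasis ι ℂ H)
    (l : ι → ℝ≥0) (he : ∀ i, S (e i) = ((l i : ℝ) : ℂ) • e i) (m : ℝ≥0) (f : H)
    (h : ∀ x, (m : ℝ≥0∞) * ENNReal.ofReal (‖⟪f, x⟫_ℂ‖ ^ 2) ≤ qform S x) :
    ∑' i, (m : ℝ≥0∞) * ENNReal.ofReal (‖⟪f, e i⟫_ℂ‖ ^ 2) / (l i : ℝ≥0∞) ≤ 1 := by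
  have hterm : ∀ i, (m : ℝ≥0∞) * ENNReal.ofReal (‖⟪f, e i⟫_ℂ‖ ^ 2) / (l i : ℝ≥0∞)
      = ENNReal.ofReal (m * (‖⟪f, e i⟫_ℂ‖ ^ 2 / l i)) := by
    intro i
    rcases eq_or_ne (l i) 0 with h0 | h0
    · have := h (e i)
      rw [qform_eigenvector (he i) (e.orthonormal.1 i), h0, ENNReal.coe_zero,
        nonpos_iff_eq_zero] at this
      rw [this, h0]
      simp
    · rw [ENNReal.ofReal_mul m.coe_nonneg, ENNReal.ofReal_coe_nnreal,
        ENNReal.ofReal_div_of_pos (NNReal.coe_pos.mpr (pos_iff_ne_zero.mpr h0)),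
        ENNReal.ofReal_coe_nnreal, mul_div_assoc]
  simp only [hterm]
  rw [ENNReal.tsum_eq_iSup_sum]
  refine iSup_le fun F => ?_
  rw [← ENNReal.ofReal_sum_of_nonneg fun i _ => by positivity, ← Finset.mul_sum,
    ENNReal.ofReal_le_one]
  set W : ℝ := ∑ i ∈ F, ‖⟪f, e i⟫_ℂ‖ ^ 2 / l i with hW
  have hW0 : 0 ≤ W := Finset.sum_nonneg fun i _ => by positivity
  -- The test vector is the truncated `S⁻¹ f`; coefficients with `l i = 0` are zero.
  let c : ι → ℂ := fun i => ⟪e i, f⟫_ℂ / ((l i : ℝ) : ℂ)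
  let x : H := ∑ i ∈ F, c i • e i
  have h1 : ⟪f, x⟫_ℂ = (W : ℂ) := by
    simp only [x, c, inner_sum, inner_smul_right, hW, Complex.ofReal_sum]
    refine Finset.sum_congr rfl fun i _ => ?_
    rw [div_mul_eq_mul_div, ← inner_conj_symm (e i) f, RCLike.conj_mul]
    simp
  have h2 : ⟪x, S x⟫_ℂ = (W : ℂ) := by
    have : S x = ∑ i ∈ F, (c i * ((l i : ℝ) : ℂ)) • e i := by
      simp [x, map_sum, he, mul_smul]
    rw [this, e.orthonormal.inner_sum, hW, Complex.ofReal_sum]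
    refine Finset.sum_congr rfl fun i _ => ?_
    rw [← mul_assoc, RCLike.conj_mul]
    rcases eq_or_ne (l i) 0 with h0 | h0
    · simp [h0]
    · have : ((l i : ℝ) : ℂ) ≠ 0 := by exact_mod_cast h0
      simp only [c, norm_div, Complex.norm_real, Real.norm_eq_abs, NNReal.abs_eq,
        norm_inner_symm (e i) f]
      push_cast
      simp only [Complex.coe_algebraMap]
      field_simp
  have h3 := h x
  rw [qform, h1, h2, ← ENNReal.ofReal_coe_nnreal, ← ENNReal.ofReal_mul m.coe_nonneg] at h3
  have h4 : (m : ℝ) * W ^ 2 ≤ W := by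
    have := (ENNReal.ofReal_le_ofReal_iff (by simpa using hW0)).mp h3
    simpa [abs_of_nonneg hW0] using this
  rcases hW0.eq_or_lt with h0 | h0
  · rw [← h0]; simp
  · nlinarith

theorem isCompactOperator_sum {κ : Type w} [Fintype κ] {T : κ → H →L[ℂ] H}
    (hc : ∀ i, IsCompactOperator (T i)) :
    IsCompactOperator (∑ i, T i : H →L[ℂ] H) := by
  refine Finset.sum_induction T (fun S : H →L[ℂ] H => IsCompactOperator S)
    (fun _ _ h1 h2 => h1.add h2) isCompactOperator_zero fun i _ => hc i

end QuadraticForm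

variable {H : Type u} [NormedAddCommGroup H] [InnerProductSpace ℂ H] [CompleteSpace H]

/-! ### Diagonalization of positive compact operators -/

/-- The spectral theorem for positive compact operators: a Hilbert basis of eigenvectors is
obtained by joining Hilbert bases of all the eigenspaces. -/
theorem exists_eigenbasis {T : H →L[ℂ] H} (hT : 0 ≤ T) (hc : IsCompactOperator T) :
    ∃ (ι : Type u) (e : HilbertBasis ι ℂ H) (l : ι → ℝ≥0), ∀ i, T (e i) = ((l i : ℝ) : ℂ) • e i := by
  have hpos := ContinuousLinearMap.nonneg_iff_isPositive T |>.mp hT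
  have hsymm : (T : H →ₗ[ℂ] H).IsSymmetric := hpos.isSymmetric
  let V : ℂ → Submodule ℂ H := fun μ => Module.End.eigenspace (T : H →ₗ[ℂ] H) μ
  have hmem : ∀ μ x, x ∈ V μ ↔ T x = μ • x := fun μ x => Module.End.mem_eigenspace_iff
  have hV : ∀ μ, IsClosed (V μ : Set H) := by
    intro μ
    have : (V μ : Set H) = {x | T x = μ • x} := Set.ext fun x => hmem μ x
    rw [this]
    exact isClosed_eq T.continuous (continuous_const_smul μ)
  have : ∀ μ, CompleteSpace (V μ) := fun μ => (hV μ).completeSpace_coe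
  have hfam := hsymm.orthogonalFamily_eigenspaces
  let ι := Σ μ : ℂ, basisIndex (V μ)
  let v : ι → H := fun s => (basis (V s.1) s.2 : H)
  have hv : Orthonormal ℂ v :=
    hfam.orthonormal_sigma_orthonormal (fun μ => (basis (V μ)).orthonormal)
  have hspan : (Submodule.span ℂ (Set.range v))ᗮ = ⊥ := by
    rw [Submodule.eq_bot_iff]
    intro x hx
    rw [Submodule.mem_orthogonal'] at hx
    have hx' : x ∈ (⨆ μ, V μ)ᗮ := by
      rw [← Submodule.iInf_orthogonal, Submodule.mem_iInf]
      intro μ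
      rw [Submodule.mem_orthogonal']
      intro y hy
      have h := ((basis (V μ)).hasSum_repr ⟨y, hy⟩).mapL ((innerSL ℂ x).comp (V μ).subtypeL)
      refine h.unique ?_
      convert! hasSum_zero with i
      have : ⟪x, v ⟨μ, i⟩⟫_ℂ = 0 := hx _ (Submodule.subset_span ⟨_, rfl⟩)
      simpa [inner_smul_right, v] using Or.inr this
    have := ContinuousLinearMap.orthogonalComplement_iSup_eigenspaces_eq_bot hc hsymm
    rw [show (⨆ μ, V μ)ᗮ = ⊥ from this] at hx'
    simpa using hx'
  have hTv : ∀ i : ι, T (v i) = i.1 • v i := fun i => (hmem _ _).mp (basis (V i.1) i.2).2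
  have hreal : ∀ i : ι, (0 : ℂ) ≤ i.1 := by
    intro i
    have h := hpos.inner_nonneg_right (v i)
    rw [hTv, inner_smul_right, inner_self_eq_norm_sq_to_K, hv.1 i] at h
    simpa using h
  refine ⟨ι, HilbertBasis.mkOfOrthogonalEqBot hv hspan,
    fun i => ⟨i.1.re, (Complex.le_def.mp (hreal i)).1⟩, fun i => ?_⟩
  simp only [HilbertBasis.coe_mkOfOrthogonalEqBot, hTv]
  congr 1
  exact Complex.eq_re_of_ofReal_le (r := 0) (by simpa using hreal i)

/-- The continuous functional calculus acts on eigenvectors through the eigenvalue; this holds for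
polynomials, hence for continuous functions by the Stone–Weierstrass theorem. -/
theorem cfc_apply_eigenvector {T : H →L[ℂ] H} (hT : IsSelfAdjoint T) {x : H} {l : ℝ}
    (hx : T x = (l : ℂ) • x) (f : ℝ → ℝ) (hf : ContinuousOn f (spectrum ℝ T)) :
    cfc f T x = (f l : ℂ) • x := by
  rcases eq_or_ne x 0 with rfl | hx0
  · simp
  have hl : l ∈ spectrum ℝ T := by
    rw [spectrum.mem_iff]
    intro hu
    apply hx0
    have h0 : (algebraMap ℝ (H →L[ℂ] H) l - T) x = 0 := by
      simp [Algebra.algebraMap_eq_smul_one, hx]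
    obtain ⟨u, hu⟩ := hu
    have := congrArg (fun S : H →L[ℂ] H => S x) u.inv_mul
    rw [hu] at this
    simpa [h0] using this.symm
  rw [cfc_apply f T hT hf]
  generalize hg : (⟨_, hf.domRestrict⟩ : C(spectrum ℝ T, ℝ)) = g
  have hgl : f l = g ⟨l, hl⟩ := by rw [← hg]; rfl
  rw [hgl]
  clear hg hgl
  induction g using ContinuousMap.induction_on_of_compact with
  | const r =>
    have : cfcHom hT (ContinuousMap.const _ r) = algebraMap ℝ (H →L[ℂ] H) r :=
      AlgHomClass.commutes (cfcHom hT : C(spectrum ℝ T, ℝ) →⋆ₐ[ℝ] (H →L[ℂ] H)) r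
    rw [this]
    simp [Algebra.algebraMap_eq_smul_one]
  | id =>
    have := cfcHom_id (R := ℝ) hT
    rw [this]
    simpa using hx
  | star_id =>
    have : star (ContinuousMap.restrict (spectrum ℝ T) (ContinuousMap.id ℝ)) =
      ContinuousMap.restrict (spectrum ℝ T) (ContinuousMap.id ℝ) := by ext; simp
    rw [this, cfcHom_id (R := ℝ) hT]
    simpa using hx
  | add f g hf hg => simp [hf, hg, add_smul]
  | mul f g hf hg => simp [hf, hg, mul_smul, smul_comm (f _ : ℂ)]
  | frequently f h =>
    -- Both sides depend continuously on `f`, so the property passes to limits.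
    have hcl : IsClosed {f : C(spectrum ℝ T, ℝ) | cfcHom hT f x = (f ⟨l, hl⟩ : ℂ) • x} := by
      refine isClosed_eq ?_ ?_
      · exact (ContinuousLinearMap.apply ℂ H x).continuous.comp (cfcHom_continuous hT)
      · exact (Complex.continuous_ofReal.comp (ContinuousEvalConst.continuous_eval_const _)).smul
          continuous_const
    exact hcl.mem_of_frequently_of_tendsto h Filter.tendsto_id

theorem posTrace_rpow_eq_tsum {T : H →L[ℂ] H} (hT : 0 ≤ T) {ι : Type*} (e : HilbertBasis ι ℂ H)
    (l : ι → ℝ≥0) (he : ∀ i, T (e i) = ((l i : ℝ) : ℂ) • e i) {q : ℝ} (hq : 0 < q) :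
    posTrace (T ^ q) = ∑' i, (l i : ℝ≥0∞) ^ q := by
  rw [← diagSum_eq_posTrace e CFC.rpow_nonneg]
  refine tsum_congr fun i => ?_
  rw [CFC.rpow_eq_cfc_real, cfc_apply_eigenvector hT.isSelfAdjoint (he i) _
    (Real.continuous_rpow_const hq.le).continuousOn, inner_smul_right,
    inner_self_eq_norm_sq_to_K, e.orthonormal.1 i, ← ENNReal.coe_rpow_of_nonneg _ hq.le]
  simp [ENNReal.ofReal, ← NNReal.coe_rpow]

theorem qform_eq_tsum {T : H →L[ℂ] H} {ι : Type*} (e : HilbertBasis ι ℂ H)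
    (l : ι → ℝ≥0) (he : ∀ i, T (e i) = ((l i : ℝ) : ℂ) • e i) (x : H) (hT : 0 ≤ T) :
    qform T x = ∑' i, (l i : ℝ≥0∞) * ENNReal.ofReal (‖⟪e i, x⟫_ℂ‖ ^ 2) := by
  have hsymm : ∀ x y, ⟪T x, y⟫_ℂ = ⟪x, T y⟫_ℂ := fun x y =>
    (ContinuousLinearMap.isSelfAdjoint_iff_isSymmetric.mp hT.isSelfAdjoint) x y
  have h : HasSum (fun i => (l i : ℝ) * ‖⟪e i, x⟫_ℂ‖ ^ 2) (RCLike.re ⟪x, T x⟫_ℂ) := by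
    have h1 := (e.hasSum_inner_mul_inner x (T x)).mapL Complex.reCLM
    refine h1.congr_fun ?_
    intro i
    rw [← hsymm, he, inner_smul_left, Complex.conj_ofReal, mul_left_comm, ← inner_conj_symm x (e i),
      RCLike.conj_mul]
    simp [← Complex.ofReal_pow]
  rw [qform, ← h.tsum_eq, ENNReal.ofReal_tsum_of_nonneg (fun i => by positivity) h.summable]
  refine tsum_congr fun i => ?_
  rw [ENNReal.ofReal_mul (l i).coe_nonneg, ENNReal.ofReal_coe_nnreal]

/-! ### Trace inequalities for sums of positive operators -/

section Family

variable {κ : Type w} [Fintype κ] {T : κ → H →L[ℂ] H}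

theorem tsum_sigma_eq_qform_sum (hT : ∀ i, 0 ≤ T i)
    {ι : κ → Type u} (f : ∀ i, HilbertBasis (ι i) ℂ H) (m : ∀ i, ι i → ℝ≥0)
    (hf : ∀ i k, T i (f i k) = ((m i k : ℝ) : ℂ) • f i k) (x : H) :
    ∑' a : Σ i, ι i, (m a.1 a.2 : ℝ≥0∞) * ENNReal.ofReal (‖⟪f a.1 a.2, x⟫_ℂ‖ ^ 2) =
      qform (∑ i, T i) x := by
  rw [qform_sum hT, ENNReal.tsum_sigma', tsum_fintype]
  exact Finset.sum_congr rfl fun i _ => (qform_eq_tsum (f i) (m i) (hf i) x (hT i)).symm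

/-- The eigenvalues `x` of all members of a family of positive compact operators and the eigenvalues
`y` of its sum are related by two matrices: `x = W y`, where the row sums of `W` are at most `1` and
its column sums are `1` wherever `y b ≠ 0`, and `y = V x`, where the row sums of `V` are the number
of operators and its column sums are `1`. -/
theorem exists_substochastic_of_sum (hT : ∀ i, 0 ≤ T i) (hc : ∀ i, IsCompactOperator (T i)) :
    ∃ (α : Type (max u w)) (β : Type u) (x : α → ℝ≥0∞) (y : β → ℝ≥0∞)
      (W : α → β → ℝ≥0∞) (V : β → α → ℝ≥0∞),
      (∀ q : ℝ, 0 < q → ∑ i, posTrace (T i ^ q) = ∑' a, x a ^ q) ∧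
      (∀ q : ℝ, 0 < q → posTrace ((∑ i, T i) ^ q) = ∑' b, y b ^ q) ∧
      ((∀ a, ∑' b, W a b ≤ 1) ∧ (∀ a, ∑' b, W a b * y b = x a) ∧
        (∀ b, y b ≠ 0 → ∑' a, W a b = 1)) ∧
      ((∀ b, ∑' a, V b a = Fintype.card κ) ∧ (∀ b, ∑' a, V b a * x a = y b) ∧
        (∀ a, ∑' b, V b a = 1)) := by
  have hS : 0 ≤ ∑ i, T i := Finset.sum_nonneg fun i _ => hT i
  have hSc : IsCompactOperator (∑ i, T i : H →L[ℂ] H) := isCompactOperator_sum hc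
  obtain ⟨β, e, l, he⟩ := exists_eigenbasis hS hSc
  choose ι f m hf using fun i => exists_eigenbasis (hT i) (hc i)
  have hq := tsum_sigma_eq_qform_sum hT f m hf
  have hle : ∀ a : Σ i, ι i, ∀ x, (m a.1 a.2 : ℝ≥0∞) * ENNReal.ofReal (‖⟪f a.1 a.2, x⟫_ℂ‖ ^ 2)
      ≤ qform (∑ i, T i) x := fun a x => by
    rw [← hq]
    exact ENNReal.le_tsum (f := fun a : Σ i, ι i =>
      (m a.1 a.2 : ℝ≥0∞) * ENNReal.ofReal (‖⟪f a.1 a.2, x⟫_ℂ‖ ^ 2)) a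
  have hqe : ∀ b, qform (∑ i, T i) (e b) = l b := fun b =>
    qform_eigenvector (he b) (e.orthonormal.1 b)
  have hpars : ∀ a : Σ i, ι i, ∑' b, ENNReal.ofReal (‖⟪f a.1 a.2, e b⟫_ℂ‖ ^ 2) = 1 := by
    intro a
    simp only [norm_inner_symm (f a.1 a.2)]
    rw [tsum_ofReal_norm_inner_sq, (f a.1).orthonormal.1]
    simp
  refine ⟨Σ i, ι i, β, fun a => m a.1 a.2, fun b => l b,
    fun a b => m a.1 a.2 * ENNReal.ofReal (‖⟪f a.1 a.2, e b⟫_ℂ‖ ^ 2) / l b,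
    fun b a => ENNReal.ofReal (‖⟪f a.1 a.2, e b⟫_ℂ‖ ^ 2), ?_, ?_, ⟨?_, ?_, ?_⟩, ?_, ?_, hpars⟩
  · intro q hq0
    rw [ENNReal.tsum_sigma', tsum_fintype]
    exact Finset.sum_congr rfl fun i _ => posTrace_rpow_eq_tsum (hT i) (f i) (m i) (hf i) hq0
  · exact fun q hq0 => posTrace_rpow_eq_tsum hS e l he hq0
  · exact fun a => tsum_div_le_one_of_le_qform e l he _ _ (hle a)
  · intro a
    have : ∀ b, m a.1 a.2 * ENNReal.ofReal (‖⟪f a.1 a.2, e b⟫_ℂ‖ ^ 2) / l b * (l b : ℝ≥0∞)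
        = m a.1 a.2 * ENNReal.ofReal (‖⟪f a.1 a.2, e b⟫_ℂ‖ ^ 2) := by
      intro b
      refine ENNReal.div_mul_cancel' (fun h0 => ?_) (fun h => absurd h ENNReal.coe_ne_top)
      have := hle a (e b)
      rwa [hqe, h0, nonpos_iff_eq_zero] at this
    simp only [this]
    rw [ENNReal.tsum_mul_left, hpars, mul_one]
  · intro b hb
    simp only [div_eq_mul_inv]
    rw [ENNReal.tsum_mul_right, hq, hqe]
    exact ENNReal.mul_inv_cancel hb ENNReal.coe_ne_top
  · intro b
    rw [ENNReal.tsum_sigma', tsum_fintype]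
    simp only [tsum_ofReal_norm_inner_sq, e.orthonormal.1 b]
    simp
  · intro b
    simp only [mul_comm (ENNReal.ofReal _)]
    rw [hq, hqe]

theorem sum_posTrace_rpow_le (hT : ∀ i, 0 ≤ T i) (hc : ∀ i, IsCompactOperator (T i)) {q : ℝ}
    (hq : 1 ≤ q) : ∑ i, posTrace (T i ^ q) ≤ posTrace ((∑ i, T i) ^ q) := by
  have hq0 : 0 < q := by linarith
  obtain ⟨α, β, x, y, W, V, hx, hy, ⟨h1, h2, h3⟩, -⟩ := exists_substochastic_of_sum hT hc
  rw [hx q hq0, hy q hq0]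
  refine (tsum_rpow_le_of_substochastic W x y hq h1 h2).trans_eq (tsum_congr fun b => ?_)
  rcases eq_or_ne (y b) 0 with h0 | h0
  · simp [h0, ENNReal.zero_rpow_of_pos hq0]
  · rw [h3 b h0, one_mul]

theorem posTrace_sum_rpow_le (hT : ∀ i, 0 ≤ T i) (hc : ∀ i, IsCompactOperator (T i)) {q : ℝ}
    (hq0 : 0 < q) (hq : q ≤ 1) : posTrace ((∑ i, T i) ^ q) ≤ ∑ i, posTrace (T i ^ q) := by
  obtain ⟨α, β, x, y, W, V, hx, hy, ⟨h1, h2, h3⟩, -⟩ := exists_substochastic_of_sum hT hc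
  rw [hx q hq0, hy q hq0]
  refine (tsum_congr fun b => ?_).trans_le (le_tsum_rpow_of_substochastic W x y hq0 hq h1 h2)
  rcases eq_or_ne (y b) 0 with h0 | h0
  · simp [h0, ENNReal.zero_rpow_of_pos hq0]
  · rw [h3 b h0, one_mul]

variable [Nonempty κ]

theorem posTrace_sum_rpow_le_card_mul (hT : ∀ i, 0 ≤ T i) (hc : ∀ i, IsCompactOperator (T i))
    {q : ℝ} (hq : 1 ≤ q) :
    posTrace ((∑ i, T i) ^ q) ≤ (Fintype.card κ : ℝ≥0∞) ^ (q - 1) * ∑ i, posTrace (T i ^ q) := by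
  have hq0 : 0 < q := by linarith
  obtain ⟨α, β, x, y, W, V, hx, hy, -, h1, h2, h3⟩ := exists_substochastic_of_sum hT hc
  have hm0 : (Fintype.card κ : ℝ≥0∞) ≠ 0 := by simp
  have hm : (Fintype.card κ : ℝ≥0∞) ≠ ∞ := by simp
  set c : ℝ≥0∞ := (Fintype.card κ : ℝ≥0∞)
  -- Dividing by `c` turns the rows of `V` into probability weights.
  have h := tsum_rpow_le_of_substochastic (fun b a => c⁻¹ * V b a) (fun b => c⁻¹ * y b) x hq
    (fun b => by rw [ENNReal.tsum_mul_left, h1, ENNReal.inv_mul_cancel hm0 hm])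
    (fun b => by simp only [mul_assoc]; rw [ENNReal.tsum_mul_left, h2])
  simp only [ENNReal.tsum_mul_left, h3, mul_one, ENNReal.mul_rpow_of_nonneg _ _ hq0.le] at h
  rw [← hx q hq0, ← hy q hq0] at h
  have h' := mul_le_mul_right h (c ^ q)
  rwa [← mul_assoc, ← mul_assoc, ENNReal.inv_rpow, ENNReal.mul_inv_cancel
    (by simp [ENNReal.rpow_eq_zero_iff, hm0, hm]) (by simp [ENNReal.rpow_eq_top_iff, hm0, hm]),
    one_mul, ← ENNReal.rpow_neg_one, ← ENNReal.rpow_add _ _ hm0 hm, ← sub_eq_add_neg] at h'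

theorem card_mul_sum_posTrace_rpow_le (hT : ∀ i, 0 ≤ T i) (hc : ∀ i, IsCompactOperator (T i))
    {q : ℝ} (hq0 : 0 < q) (hq : q ≤ 1) :
    (Fintype.card κ : ℝ≥0∞) ^ (q - 1) * ∑ i, posTrace (T i ^ q) ≤ posTrace ((∑ i, T i) ^ q) := by
  obtain ⟨α, β, x, y, W, V, hx, hy, -, h1, h2, h3⟩ := exists_substochastic_of_sum hT hc
  have hm0 : (Fintype.card κ : ℝ≥0∞) ≠ 0 := by simp
  have hm : (Fintype.card κ : ℝ≥0∞) ≠ ∞ := by simp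
  set c : ℝ≥0∞ := (Fintype.card κ : ℝ≥0∞)
  -- Dividing by `c` turns the rows of `V` into probability weights.
  have h := le_tsum_rpow_of_substochastic (fun b a => c⁻¹ * V b a) (fun b => c⁻¹ * y b) x hq0 hq
    (fun b => by rw [ENNReal.tsum_mul_left, h1, ENNReal.inv_mul_cancel hm0 hm])
    (fun b => by simp only [mul_assoc]; rw [ENNReal.tsum_mul_left, h2])
  simp only [ENNReal.tsum_mul_left, h3, mul_one, ENNReal.mul_rpow_of_nonneg _ _ hq0.le] at h
  rw [← hx q hq0, ← hy q hq0] at h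
  have h' := mul_le_mul_right h (c ^ q)
  rwa [← mul_assoc, ← mul_assoc, ENNReal.inv_rpow, ENNReal.mul_inv_cancel
    (by simp [ENNReal.rpow_eq_zero_iff, hm0, hm]) (by simp [ENNReal.rpow_eq_top_iff, hm0, hm]),
    one_mul, ← ENNReal.rpow_neg_one, ← ENNReal.rpow_add _ _ hm0 hm, ← sub_eq_add_neg] at h'

end Family

/-! ### Schatten classes -/

theorem posTrace_abs_rpow (A : H →L[ℂ] H) {p : ℝ} (hp : 0 < p) :
    posTrace (CFC.abs A ^ p) = posTrace ((star A * A) ^ (p / 2)) := by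
  rw [CFC.abs, CFC.sqrt_eq_rpow, CFC.rpow_rpow_of_exponent_nonneg _ _ _ (by norm_num) hp.le
    (star_mul_self_nonneg A)]
  congr 2
  ring

theorem schattenNorm_rpow (A : H →L[ℂ] H) {p : ℝ} (hp : 0 < p) :
    schattenNorm p A ^ p = (posTrace ((star A * A) ^ (p / 2))).toReal := by
  rw [schattenNorm, schattenENorm, ENNReal.toReal_rpow, ← ENNReal.rpow_mul,
    one_div_mul_cancel hp.ne', ENNReal.rpow_one, posTrace_abs_rpow A hp]

theorem memSchatten_iff (A : H →L[ℂ] H) {p : ℝ} (hp : 0 < p) :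
    MemSchatten p A ↔ IsCompactOperator A ∧ posTrace ((star A * A) ^ (p / 2)) < ∞ := by
  rw [MemSchatten, schattenENorm, ENNReal.rpow_lt_top_iff_of_pos (by positivity),
    posTrace_abs_rpow A hp]

theorem isCompactOperator_star_mul_self {A : H →L[ℂ] H} (hA : IsCompactOperator A) :
    IsCompactOperator (star A * A) := hA.clm_comp (star A)

section Compare

variable {κ κ' : Type*} [Fintype κ] [Fintype κ'] {X : κ → H →L[ℂ] H} {Y : κ' → H →L[ℂ] H}

/-- Two families of compact operators with `∑ |X_i|² = ∑ |Y_i|²` are compared through the trace of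
the `q`-th power of the common sum. -/
theorem sum_posTrace_le_card_mul_of_sum_eq [Nonempty κ'] (hX : ∀ i, IsCompactOperator (X i))
    (hY : ∀ i, IsCompactOperator (Y i)) (h : ∑ i, star (X i) * X i = ∑ i, star (Y i) * Y i)
    {q : ℝ} (hq : 1 ≤ q) :
    ∑ i, posTrace ((star (X i) * X i) ^ q)
      ≤ (Fintype.card κ' : ℝ≥0∞) ^ (q - 1) * ∑ i, posTrace ((star (Y i) * Y i) ^ q) := by
  refine (sum_posTrace_rpow_le (fun i => star_mul_self_nonneg (X i))
    (fun i => isCompactOperator_star_mul_self (hX i)) hq).trans ?_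
  rw [h]
  exact posTrace_sum_rpow_le_card_mul (fun i => star_mul_self_nonneg (Y i))
    (fun i => isCompactOperator_star_mul_self (hY i)) hq

/-- The analogue of `sum_posTrace_le_card_mul_of_sum_eq` for concave powers, where the inequality is
reversed. -/
theorem card_mul_sum_posTrace_le_of_sum_eq [Nonempty κ'] (hX : ∀ i, IsCompactOperator (X i))
    (hY : ∀ i, IsCompactOperator (Y i)) (h : ∑ i, star (X i) * X i = ∑ i, star (Y i) * Y i)
    {q : ℝ} (hq0 : 0 < q) (hq : q ≤ 1) :
    (Fintype.card κ' : ℝ≥0∞) ^ (q - 1) * ∑ i, posTrace ((star (Y i) * Y i) ^ q)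
      ≤ ∑ i, posTrace ((star (X i) * X i) ^ q) := by
  refine le_trans ?_ (posTrace_sum_rpow_le (fun i => star_mul_self_nonneg (X i))
    (fun i => isCompactOperator_star_mul_self (hX i)) hq0 hq)
  rw [h]
  exact card_mul_sum_posTrace_rpow_le (fun i => star_mul_self_nonneg (Y i))
    (fun i => isCompactOperator_star_mul_self (hY i)) hq0 hq

end Compare

theorem MemSchatten.add {p : ℝ} (hp : 0 < p) {A B : H →L[ℂ] H} (hA : MemSchatten p A)
    (hB : MemSchatten p B) : MemSchatten p (A + B) := by
  rw [memSchatten_iff _ hp] at *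
  refine ⟨hA.1.add hB.1, ?_⟩
  -- In both ranges of `p`, finiteness for `A + B` comes from the comparison of the pair `A ± B`
  -- with the family in which `A` and `B` occur twice.
  let X : Bool → H →L[ℂ] H := fun s => bif s then A + B else A - B
  let Y : Bool × Bool → H →L[ℂ] H := fun s => bif s.1 then A else B
  have hX : ∀ s, IsCompactOperator (X s) := by
    rintro (_ | _)
    exacts [hA.1.sub hB.1, hA.1.add hB.1]
  have hY : ∀ s, IsCompactOperator (Y s) := by
    rintro ⟨_ | _, _⟩
    exacts [hB.1, hA.1]
  -- The parallelogram identity.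
  have hXY : ∑ s, star (X s) * X s = ∑ s, star (Y s) * Y s := by
    simp only [X, Y, Fintype.sum_prod_type, Fintype.sum_bool, cond_true, cond_false, star_add,
      star_sub]
    noncomm_ring
  have hfin : ∑ s, posTrace ((star (Y s) * Y s) ^ (p / 2)) < ∞ := by
    rw [ENNReal.sum_lt_top]
    rintro ⟨_ | _, _⟩ -
    exacts [hB.2, hA.2]
  suffices hs : ∑ s, posTrace ((star (X s) * X s) ^ (p / 2)) < ∞ from
    (ENNReal.sum_lt_top.mp hs) true (Finset.mem_univ _)
  rcases le_total 1 (p / 2) with hq | hq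
  · refine (sum_posTrace_le_card_mul_of_sum_eq hX hY hXY hq).trans_lt (ENNReal.mul_lt_top ?_ hfin)
    exact ENNReal.rpow_lt_top_of_nonneg (by linarith) (by simp)
  -- For concave powers the two families exchange their roles.
  · have h := card_mul_sum_posTrace_le_of_sum_eq hY hX hXY.symm (half_pos hp) hq
    refine ENNReal.lt_top_of_mul_ne_top_right (h.trans_lt hfin).ne ?_
    simp [ENNReal.rpow_eq_zero_iff]

theorem MemSchatten.neg {p : ℝ} (hp : 0 < p) {A : H →L[ℂ] H} (hA : MemSchatten p A) :
    MemSchatten p (-A) := by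
  rw [memSchatten_iff _ hp] at *
  refine ⟨hA.1.neg, ?_⟩
  simpa using hA.2

theorem schattenNorm_neg_rpow {p : ℝ} (hp : 0 < p) (A : H →L[ℂ] H) :
    schattenNorm p (-A) ^ p = schattenNorm p A ^ p := by
  simp [schattenNorm_rpow _ hp]

section Orthogonal

variable {n : ℕ} {p : ℝ} {A B : Fin n → H →L[ℂ] H}

/-- The cross terms of `∑ |A_i + B_j|²` cancel by hypothesis; `n (∑ |A_i|² + ∑ |B_i|²)` is written
as the sum of a family in which every operator occurs `n` times. -/
theorem sum_star_mul_self_add (hAB : ∑ i, ∑ j, star (A i) * B j = 0) :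
    ∑ s : Fin n × Fin n, star (A s.1 + B s.2) * (A s.1 + B s.2) =
      ∑ s : (Fin n ⊕ Fin n) × Fin n, star (Sum.elim A B s.1) * Sum.elim A B s.1 := by
  have hBA : ∑ i, ∑ j, star (B j) * A i = 0 := by
    simpa [star_sum] using congrArg star hAB
  simp only [Fintype.sum_prod_type, Fintype.sum_sum_type, Sum.elim_inl, Sum.elim_inr, star_add,
    add_mul, mul_add, Finset.sum_add_distrib, hAB, hBA, add_zero, zero_add]
  congr 1
  rw [Finset.sum_comm]

/-- The factor `n` is the multiplicity of each operator in the family of `2 n²` operators. -/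
theorem card_rpow_toReal (hn : n ≠ 0) (p : ℝ) :
    ((Fintype.card ((Fin n ⊕ Fin n) × Fin n) : ℝ≥0∞) ^ (p / 2 - 1)).toReal * n =
      (2 : ℝ) ^ (p / 2 - 1) * (n : ℝ) ^ (p - 1) := by
  have hn' : (0 : ℝ) < n := by positivity
  rw [← ENNReal.toReal_rpow, ENNReal.toReal_natCast]
  simp only [Fintype.card_prod, Fintype.card_sum, Fintype.card_fin]
  push_cast
  rw [show ((n : ℝ) + n) * n = 2 * (n : ℝ) ^ (2 : ℝ) by rw [Real.rpow_two]; ring,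
    Real.mul_rpow (by norm_num) (by positivity), ← Real.rpow_mul hn'.le, mul_assoc,
    ← Real.rpow_add_one hn'.ne']
  ring_nf

theorem sum_posTrace_elim (hp : 0 < p) (hA : ∀ i, MemSchatten p (A i))
    (hB : ∀ j, MemSchatten p (B j)) :
    (∑ s : (Fin n ⊕ Fin n) × Fin n,
      posTrace ((star (Sum.elim A B s.1) * Sum.elim A B s.1) ^ (p / 2))).toReal =
      n * (∑ i, schattenNorm p (A i) ^ p + ∑ i, schattenNorm p (B i) ^ p) := by
  have hA' := fun i => ((memSchatten_iff _ hp).mp (hA i)).2.ne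
  have hB' := fun i => ((memSchatten_iff _ hp).mp (hB i)).2.ne
  rw [ENNReal.toReal_sum]
  · simp [Fintype.sum_prod_type, schattenNorm_rpow _ hp, mul_add, Finset.mul_sum]
  · rintro ⟨i | i, j⟩ -
    exacts [hA' i, hB' i]

theorem sum_posTrace_add (hp : 0 < p) (hAB : ∀ i j, MemSchatten p (A i + B j)) :
    (∑ s : Fin n × Fin n,
      posTrace ((star (A s.1 + B s.2) * (A s.1 + B s.2)) ^ (p / 2))).toReal =
      ∑ i, ∑ j, schattenNorm p (A i + B j) ^ p := by
  rw [ENNReal.toReal_sum]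
  · simp [Fintype.sum_prod_type, schattenNorm_rpow _ hp]
  · exact fun s _ => ((memSchatten_iff _ hp).mp (hAB s.1 s.2)).2.ne

theorem sum_schattenNorm_add_le (hp : 2 ≤ p) (hA : ∀ i, MemSchatten p (A i))
    (hB : ∀ j, MemSchatten p (B j)) (hAB : ∑ i, ∑ j, star (A i) * B j = 0) :
    ∑ i, ∑ j, schattenNorm p (A i + B j) ^ p ≤ (2 : ℝ) ^ (p / 2 - 1) * (n : ℝ) ^ (p - 1) *
      (∑ i, schattenNorm p (A i) ^ p + ∑ i, schattenNorm p (B i) ^ p) := by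
  have hp0 : 0 < p := by linarith
  rcases eq_or_ne n 0 with rfl | hn
  · simp
  have : Nonempty (Fin n) := Fin.pos_iff_nonempty.mp (Nat.pos_of_ne_zero hn)
  have h := sum_posTrace_le_card_mul_of_sum_eq
    (X := fun s : Fin n × Fin n => A s.1 + B s.2)
    (Y := fun s : (Fin n ⊕ Fin n) × Fin n => Sum.elim A B s.1) (fun s => (hA s.1).1.add (hB s.2).1)
    (by rintro ⟨i | i, _⟩; exacts [(hA i).1, (hB i).1]) (sum_star_mul_self_add hAB)
    (q := p / 2) (by linarith)
  rw [← sum_posTrace_add hp0 fun i j => (hA i).add hp0 (hB j), ← card_rpow_toReal hn, mul_assoc,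
    ← sum_posTrace_elim hp0 hA hB, ← ENNReal.toReal_mul]
  refine ENNReal.toReal_mono (ENNReal.mul_ne_top
    (ENNReal.rpow_ne_top_of_nonneg (by linarith) (ENNReal.natCast_ne_top _)) ?_) h
  refine (ENNReal.sum_lt_top.mpr ?_).ne
  rintro ⟨i | i, _⟩ -
  exacts [((memSchatten_iff _ hp0).mp (hA i)).2, ((memSchatten_iff _ hp0).mp (hB i)).2]

theorem le_sum_schattenNorm_add (hp0 : 0 < p) (hp : p ≤ 2) (hA : ∀ i, MemSchatten p (A i))
    (hB : ∀ j, MemSchatten p (B j)) (hAB : ∑ i, ∑ j, star (A i) * B j = 0) :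
    (2 : ℝ) ^ (p / 2 - 1) * (n : ℝ) ^ (p - 1) *
      (∑ i, schattenNorm p (A i) ^ p + ∑ i, schattenNorm p (B i) ^ p) ≤
      ∑ i, ∑ j, schattenNorm p (A i + B j) ^ p := by
  rcases eq_or_ne n 0 with rfl | hn
  · simp
  have : Nonempty (Fin n) := Fin.pos_iff_nonempty.mp (Nat.pos_of_ne_zero hn)
  have h := card_mul_sum_posTrace_le_of_sum_eq
    (X := fun s : Fin n × Fin n => A s.1 + B s.2)
    (Y := fun s : (Fin n ⊕ Fin n) × Fin n => Sum.elim A B s.1) (fun s => (hA s.1).1.add (hB s.2).1)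
    (by rintro ⟨i | i, _⟩; exacts [(hA i).1, (hB i).1]) (sum_star_mul_self_add hAB)
    (q := p / 2) (by linarith) (by linarith)
  rw [← sum_posTrace_add hp0 fun i j => (hA i).add hp0 (hB j), ← card_rpow_toReal hn, mul_assoc,
    ← sum_posTrace_elim hp0 hA hB, ← ENNReal.toReal_mul]
  exact ENNReal.toReal_mono (ENNReal.sum_lt_top.mpr fun s _ =>
    ((memSchatten_iff _ hp0).mp ((hA s.1).add hp0 (hB s.2))).2).ne h

end Orthogonal

end SchattenClass

theorem mainTheorem1 {H : Type*} [NormedAddCommGroup H] [InnerProductSpace ℂ H] [CompleteSpace H]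
    [TopologicalSpace.SeparableSpace H] (n : ℕ) (p : ℝ) (hp : 0 < p) (A B : Fin n → H →L[ℂ] H)
    (hA : ∀ i, SchattenClass.MemSchatten p (A i)) (hB : ∀ j, SchattenClass.MemSchatten p (B j))
    (hAB : ∑ i, ∑ j, ContinuousLinearMap.adjoint (A i) * B j = 0) :
    (∀ i j, SchattenClass.MemSchatten p (A i + B j) ∧ SchattenClass.MemSchatten p (A i - B j)) ∧
    (p ≤ 2 →
      (2 : ℝ) ^ (p / 2 - 1) * (n : ℝ) ^ (p - 1) *
          (∑ i, SchattenClass.schattenNorm p (A i) ^ p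
            + ∑ i, SchattenClass.schattenNorm p (B i) ^ p)
        ≤ ∑ i, ∑ j, SchattenClass.schattenNorm p (A i + B j) ^ p ∧
      (2 : ℝ) ^ (p / 2 - 1) * (n : ℝ) ^ (p - 1) *
          (∑ i, SchattenClass.schattenNorm p (A i) ^ p
            + ∑ i, SchattenClass.schattenNorm p (B i) ^ p)
        ≤ ∑ i, ∑ j, SchattenClass.schattenNorm p (A i - B j) ^ p) ∧
    (2 ≤ p →
      ∑ i, ∑ j, SchattenClass.schattenNorm p (A i + B j) ^ p
        ≤ (2 : ℝ) ^ (p / 2 - 1) * (n : ℝ) ^ (p - 1) *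
          (∑ i, SchattenClass.schattenNorm p (A i) ^ p
            + ∑ i, SchattenClass.schattenNorm p (B i) ^ p) ∧
      ∑ i, ∑ j, SchattenClass.schattenNorm p (A i - B j) ^ p
        ≤ (2 : ℝ) ^ (p / 2 - 1) * (n : ℝ) ^ (p - 1) *
          (∑ i, SchattenClass.schattenNorm p (A i) ^ p
            + ∑ i, SchattenClass.schattenNorm p (B i) ^ p)) := by
  have hB' : ∀ j, SchattenClass.MemSchatten p (-B j) := fun j => (hB j).neg hp
  have hAB' : ∑ i, ∑ j, star (A i) * -B j = 0 := by
    simpa [ContinuousLinearMap.star_eq_adjoint] using hAB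
  refine ⟨fun i j => ⟨(hA i).add hp (hB j), ?_⟩, fun h => ⟨?_, ?_⟩, fun h => ⟨?_, ?_⟩⟩
  · rw [sub_eq_add_neg]
    exact (hA i).add hp (hB' j)
  · exact SchattenClass.le_sum_schattenNorm_add hp h hA hB hAB
  · simpa only [SchattenClass.schattenNorm_neg_rpow hp, ← sub_eq_add_neg] using
      SchattenClass.le_sum_schattenNorm_add hp h hA hB' hAB'
  · exact SchattenClass.sum_schattenNorm_add_le h hA hB hAB
  · simpa only [SchattenClass.schattenNorm_neg_rpow hp, ← sub_eq_add_neg] using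
      SchattenClass.sum_schattenNorm_add_le h hA hB' hAB'
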